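/- Let $m\ge 1$ be an integer and let $q$ be a complex number with $0<|q|<1$. Write $(a;q)_n=\prod_{k=0}^{n-1}(1-aq^k)$, $(a;q)_\infty=\prod_{k=0}^{\infty}(1-aq^k)$ and $(a,b;q)_\infty=(a;q)_\infty(b;q)_\infty$. For integers $N,k$ let $$\left[\begin{matrix}N\\k\end{matrix}\right]=\begin{cases}\dfrac{(q;q)_N}{(q;q)_k(q;q)_{N-k}}, & 0\le k\le N,\\ 0,&\text{otherwise.}\end{cases}$$ Then the series on the left below converges absolutely, and $$\sum_{n=0}^{\infty}\frac{q^{n^2-mn}}{(q;q)_n}=\frac{a_m(q)}{(q,q^4;q^5)_\infty}+\frac{b_m(q)}{(q^2,q^3;q^5)_\infty},$$ where, the (finite) sums being over all integers $n$, $$a_m(q)=\sum_{n}q^{n^2-mn}\left[\begin{matrix}m-n\\n\end{matrix}\right],\qquad b_m(q)=\sum_{n}q^{n^2-mn}\left[\begin{matrix}m-1-n\\n\end{matrix}\right].$$ -/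

import Mathlib

noncomputable section

/-- The finite `q`-shifted factorial `(a; q)_n = ∏_{k=0}^{n-1} (1 - a q^k)`. -/
def qPoch (a q : ℂ) (n : ℕ) : ℂ :=
  ∏ k ∈ Finset.range n, (1 - a * q ^ k)

/-- The infinite `q`-shifted factorial `(a; q)_∞ = ∏_{k=0}^∞ (1 - a q^k)`. -/
def qPochInf (a q : ℂ) : ℂ :=
  ∏' k : ℕ, (1 - a * q ^ k)

/-- For `|q| < 1` the product defining `(a; q)_∞` converges. -/
theorem multipliable_qPochInf (a q : ℂ) (hq : ‖q‖ < 1) :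
    Multipliable fun k : ℕ => 1 - a * q ^ k := by
  have h : Summable fun k : ℕ => ‖-(a * q ^ k)‖ := by
    simp only [norm_neg, norm_mul, norm_pow]
    exact (summable_geometric_of_lt_one (norm_nonneg q) hq).mul_left ‖a‖
  simpa only [sub_eq_add_neg] using multipliable_one_add_of_summable h

/-- The Gaussian polynomial `[N choose k]_q` for integers `N`, `k`:
`(q; q)_N / ((q; q)_k (q; q)_{N-k})` if `0 ≤ k ≤ N`, and `0` otherwise. -/
def gaussBinom (q : ℂ) (N k : ℤ) : ℂ :=
  if 0 ≤ k ∧ k ≤ N then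
    qPoch q q N.toNat / (qPoch q q k.toNat * qPoch q q (N - k).toNat)
  else 0

/-- `a_m(q) = ∑_n q^(n² - mn) [m - n choose n]_q`. The sum is over all integers `n`;
only the terms with `0 ≤ n ≤ m - n` can be nonzero. -/
def rrA (m : ℕ) (q : ℂ) : ℂ :=
  ∑ᶠ n : ℤ, q ^ (n ^ 2 - m * n) * gaussBinom q (m - n) n

/-- `b_m(q) = ∑_n q^(n² - mn) [m - 1 - n choose n]_q`. The sum is over all integers `n`;
only the terms with `0 ≤ n ≤ m - 1 - n` can be nonzero. -/
def rrB (m : ℕ) (q : ℂ) : ℂ :=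
  ∑ᶠ n : ℤ, q ^ (n ^ 2 - m * n) * gaussBinom q (m - 1 - n) n

end

open Filter Topology

/-! Put `F_j = ∑ q^(n²+jn)/(q;q)_n` for integers `j`. The series satisfies `F_j = F_{j+1} + q^(j+1)
F_{j+2}` (`tsum_rrTerm_rec`), so `F_{-m}` is a combination of `F_0` and `F_1`. The coefficients obey
the same recurrence in `m` by the `q`-Pascal rule (`rrCoeff_rec`), which identifies them with `a_m`
and `b_m`. The values of `F_0` and `F_1` are the Rogers–Ramanujan identities. Let `H_m(j)` be the
sum of `hardyWrightTerm q m j`. Then `H_2(j)` and `(q;q)_∞ F_j` satisfy the same recurrence for `j ≥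
0` and have the same limit, hence agree. `H_2(0)` and `H_2(1) = H_1(0)` are products by the Jacobi
triple product with base `q^5`. -/

theorem qPoch_succ (a q : ℂ) (n : ℕ) : qPoch a q (n + 1) = qPoch a q n * (1 - a * q ^ n) :=
  Finset.prod_range_succ _ _

theorem qPoch_zero (a q : ℂ) : qPoch a q 0 = 1 := rfl

theorem qPoch_self_succ (q : ℂ) (n : ℕ) :
    qPoch q q (n + 1) = qPoch q q n * (1 - q ^ (n + 1)) := by
  rw [qPoch_succ, pow_succ']

theorem one_sub_pow_ne_zero {q : ℂ} (hq : ‖q‖ < 1) {n : ℕ} (hn : n ≠ 0) : 1 - q ^ n ≠ 0 := by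
  intro h
  have h1 : ‖q ^ n‖ = 1 := by rw [← sub_eq_zero.mp h, norm_one]
  rw [norm_pow] at h1
  exact (pow_lt_one₀ (norm_nonneg q) hq hn).ne h1

theorem qPoch_self_ne_zero {q : ℂ} (hq : ‖q‖ < 1) (n : ℕ) : qPoch q q n ≠ 0 := by
  refine Finset.prod_ne_zero_iff.mpr fun k _ => ?_
  rw [← pow_succ']
  exact one_sub_pow_ne_zero hq k.succ_ne_zero

theorem tendsto_qPoch (a : ℂ) {q : ℂ} (hq : ‖q‖ < 1) :
    Tendsto (qPoch a q) atTop (𝓝 (qPochInf a q)) :=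
  (multipliable_qPochInf a q hq).tendsto_prod_tprod_nat

theorem qPochInf_ne_zero {a q : ℂ} (ha : ‖a‖ < 1) (hq : ‖q‖ < 1) : qPochInf a q ≠ 0 := by
  have h : Summable fun k : ℕ => ‖-(a * q ^ k)‖ := by
    simp only [norm_neg, norm_mul, norm_pow]
    exact (summable_geometric_of_lt_one (norm_nonneg q) hq).mul_left ‖a‖
  have := tprod_one_add_ne_zero_of_summable (f := fun k : ℕ => -(a * q ^ k)) (fun k hk => ?_) h
  · simpa only [qPochInf, sub_eq_add_neg] using this
  · have h1 : ‖a * q ^ k‖ = 1 := by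
      rw [← norm_one (α := ℂ)]
      congr 1
      linear_combination -hk
    rw [norm_mul, norm_pow] at h1
    have : ‖q‖ ^ k ≤ 1 := pow_le_one₀ (norm_nonneg q) hq.le
    nlinarith [norm_nonneg a, pow_nonneg (norm_nonneg q) k]

theorem exists_norm_qPoch_le (a : ℂ) {q : ℂ} (hq : ‖q‖ < 1) :
    ∃ C, 0 < C ∧ ∀ n, ‖qPoch a q n‖ ≤ C := by
  obtain ⟨C, hC, h⟩ := (Metric.isBounded_range_of_tendsto _ (tendsto_qPoch a hq)).exists_pos_norm_le
  exact ⟨C, hC, fun n => h _ ⟨n, rfl⟩⟩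

theorem exists_norm_inv_qPoch_self_le {q : ℂ} (hq : ‖q‖ < 1) :
    ∃ C, 0 < C ∧ ∀ n, ‖(qPoch q q n)⁻¹‖ ≤ C := by
  obtain ⟨C, hC, h⟩ := (Metric.isBounded_range_of_tendsto _
    ((tendsto_qPoch q hq).inv₀ (qPochInf_ne_zero hq hq))).exists_pos_norm_le
  exact ⟨C, hC, fun n => h _ ⟨n, rfl⟩⟩

/-! ### The series `F_j`: convergence, recurrence, limit. -/

theorem choose_two_succ (n : ℕ) : (n + 1).choose 2 = n.choose 2 + n := by
  rw [Nat.choose_succ_succ' n 1, Nat.choose_one_right, add_comm]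

theorem two_mul_choose_two (n : ℕ) : 2 * (n.choose 2 : ℤ) = n * (n - 1) := by
  induction n with
  | zero => simp
  | succ n ih =>
    rw [choose_two_succ]
    push_cast
    linear_combination ih

theorem summable_pow_choose_two_mul_pow {r : ℝ} (hr0 : 0 < r) (hr : r < 1) {s : ℝ} (hs : 0 < s) :
    Summable fun n : ℕ => r ^ n.choose 2 * s ^ n := by
  refine summable_of_ratio_test_tendsto_lt_one (l := 0) zero_lt_one
    (Eventually.of_forall fun n => by positivity) ?_
  have h : Tendsto (fun n : ℕ => r ^ n * s) atTop (𝓝 (0 * s)) :=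
    (tendsto_pow_atTop_nhds_zero_of_lt_one hr0.le hr).mul_const s
  rw [zero_mul] at h
  refine h.congr fun n => ?_
  rw [choose_two_succ, Real.norm_of_nonneg (by positivity), Real.norm_of_nonneg (by positivity)]
  field_simp
  ring

/-- The series `∑ q^(n² + jn) / (q; q)_n`. -/
noncomputable def rrTerm (q : ℂ) (j : ℤ) (n : ℕ) : ℂ := q ^ ((n : ℤ) ^ 2 + j * n) / qPoch q q n

/-- Uses `n² + jn = 2·C(n,2) + (1+j)n`; for negative `j` the base `‖q‖^(1+j)` may exceed 1, but the
quadratic exponent wins. -/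
theorem rrTerm_norm_le {q : ℂ} (hq0 : q ≠ 0) (j : ℤ) {C : ℝ}
    (hC : ∀ n, ‖(qPoch q q n)⁻¹‖ ≤ C) (n : ℕ) :
    ‖rrTerm q j n‖ ≤ C * ((‖q‖ ^ 2) ^ n.choose 2 * (‖q‖ ^ (1 + j)) ^ n) := by
  have h0 : ‖q‖ ≠ 0 := norm_ne_zero_iff.mpr hq0
  have h : ‖q‖ ^ ((n : ℤ) ^ 2 + j * n) = (‖q‖ ^ 2) ^ n.choose 2 * (‖q‖ ^ (1 + j)) ^ n := by
    rw [← pow_mul, ← zpow_natCast (‖q‖ ^ (1 + j)), ← zpow_mul, ← zpow_natCast ‖q‖, ← zpow_add₀ h0]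
    congr 1
    push_cast
    linear_combination -two_mul_choose_two n
  rw [rrTerm, div_eq_mul_inv, norm_mul, norm_zpow, h, mul_comm]
  exact mul_le_mul_of_nonneg_right (hC n) (by positivity)

theorem summable_rrTerm {q : ℂ} (hq0 : q ≠ 0) (hq : ‖q‖ < 1) (j : ℤ) : Summable (rrTerm q j) := by
  obtain ⟨C, hC, h⟩ := exists_norm_inv_qPoch_self_le hq
  have h0 : 0 < ‖q‖ := norm_pos_iff.mpr hq0
  exact Summable.of_norm_bounded ((summable_pow_choose_two_mul_pow (by positivity)
    (pow_lt_one₀ h0.le hq two_ne_zero) (by positivity)).mul_left C) (rrTerm_norm_le hq0 j h)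

/-- In `F_j - F_{j+1}` the factor `1 - q^n` kills the term `n = 0` and cancels the last factor of
`(q;q)_n`; shifting `n` gives `F_{j+2}`. -/
theorem tsum_rrTerm_rec {q : ℂ} (hq0 : q ≠ 0) (hq : ‖q‖ < 1) (j : ℤ) :
    ∑' n, rrTerm q j n = ∑' n, rrTerm q (j + 1) n + q ^ (j + 1) * ∑' n, rrTerm q (j + 2) n := by
  have hs := summable_rrTerm hq0 hq
  rw [← sub_eq_iff_eq_add', ← (hs j).tsum_sub (hs (j + 1)),
    ((hs j).sub (hs (j + 1))).tsum_eq_zero_add, ← tsum_mul_left]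
  have : rrTerm q j 0 - rrTerm q (j + 1) 0 = 0 := by simp [rrTerm]
  rw [this, zero_add]
  refine tsum_congr fun n => ?_
  have h1 := qPoch_self_ne_zero hq n
  have h2 := one_sub_pow_ne_zero hq n.succ_ne_zero
  simp only [rrTerm, qPoch_self_succ]
  have e1 : q ^ (((n + 1 : ℕ) : ℤ) ^ 2 + (j + 1) * (n + 1 : ℕ))
      = q ^ (((n + 1 : ℕ) : ℤ) ^ 2 + j * (n + 1 : ℕ)) * q ^ (n + 1) := by
    rw [← zpow_natCast q (n + 1), ← zpow_add₀ hq0]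
    congr 1
    ring
  have e2 : q ^ (((n + 1 : ℕ) : ℤ) ^ 2 + j * (n + 1 : ℕ))
      = q ^ (j + 1) * q ^ ((n : ℤ) ^ 2 + (j + 2) * n) := by
    rw [← zpow_add₀ hq0]
    congr 1
    push_cast
    ring
  rw [e1, e2]
  simp only [Nat.succ_eq_add_one] at h2
  field_simp

theorem tendsto_tsum_rrTerm {q : ℂ} (hq0 : q ≠ 0) (hq : ‖q‖ < 1) :
    Tendsto (fun j : ℕ => ∑' n, rrTerm q j n) atTop (𝓝 1) := by
  obtain ⟨C, hC, h⟩ := exists_norm_inv_qPoch_self_le hq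
  have h0 : 0 < ‖q‖ := norm_pos_iff.mpr hq0
  have key : Tendsto (fun j : ℕ => ∑' n, rrTerm q j n) atTop
      (𝓝 (∑' n : ℕ, if n = 0 then (1 : ℂ) else 0)) := by
    refine tendsto_tsum_of_dominated_convergence
      ((summable_pow_choose_two_mul_pow (r := ‖q‖ ^ 2) (s := 1) (by positivity)
        (pow_lt_one₀ h0.le hq two_ne_zero) (by positivity)).mul_left C) (fun n => ?_)
      (Eventually.of_forall fun j n => (rrTerm_norm_le hq0 j h n).trans ?_)
    · rcases eq_or_ne n 0 with rfl | hn
      · simp [rrTerm, qPoch_zero]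
      · rw [if_neg hn]
        have h1 : Tendsto (fun j : ℕ => q ^ (n ^ 2) / qPoch q q n * (q ^ n) ^ j) atTop
            (𝓝 (q ^ (n ^ 2) / qPoch q q n * 0)) :=
          (tendsto_pow_atTop_nhds_zero_of_norm_lt_one
            (by rw [norm_pow]; exact pow_lt_one₀ h0.le hq hn)).const_mul _
        rw [mul_zero] at h1
        refine h1.congr fun j => ?_
        have : q ^ ((n : ℤ) ^ 2 + j * n) = q ^ (n ^ 2) * (q ^ n) ^ j := by
          rw [← pow_mul, ← pow_add, ← zpow_natCast]
          congr 1
          push_cast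
          ring
        rw [rrTerm, this]
        ring
    · gcongr
      rw [show (1 + (j : ℤ)) = ((1 + j : ℕ) : ℤ) by push_cast; ring, zpow_natCast]
      exact pow_le_one₀ h0.le hq.le
  rwa [tsum_ite_eq] at key

/-! ### The Hardy–Wright series. -/

/-- For `m ≤ 2`, the terms of the Hardy–Wright series `H_m(a)` at `a = q^(j + 1)`, multiplied by
`(q; q)_∞`. -/
noncomputable def hardyWrightTerm (q : ℂ) (m j n : ℕ) : ℂ :=
  (-1) ^ n * q ^ (5 * n.choose 2 + (2 * j + (5 - m)) * n) * (1 - q ^ (m * (2 * n + j + 1)))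
    * (qPoch q q (j + n) / qPoch q q n)

theorem exists_hardyWrightTerm_norm_le {q : ℂ} (hq0 : q ≠ 0) (hq : ‖q‖ < 1) (m : ℕ) :
    ∃ C, 0 < C ∧ ∀ j n, ‖hardyWrightTerm q m j n‖ ≤ C * (‖q‖ ^ n.choose 2 * 1 ^ n) := by
  obtain ⟨C, hC, h⟩ := exists_norm_inv_qPoch_self_le hq
  obtain ⟨D, hD, h'⟩ := exists_norm_qPoch_le q hq
  have h0 : 0 < ‖q‖ := norm_pos_iff.mpr hq0
  refine ⟨2 * (D * C), by positivity, fun j n => ?_⟩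
  simp only [hardyWrightTerm, norm_mul, norm_pow, norm_neg, norm_one, one_pow, one_mul, mul_one,
    div_eq_mul_inv]
  have h1 : ‖q‖ ^ (5 * n.choose 2 + (2 * j + (5 - m)) * n) ≤ ‖q‖ ^ n.choose 2 :=
    pow_le_pow_of_le_one h0.le hq.le (by nlinarith [Nat.zero_le ((2 * j + (5 - m)) * n)])
  have h2 : ‖1 - q ^ (m * (2 * n + j + 1))‖ ≤ 2 := by
    refine (norm_sub_le _ _).trans ?_
    rw [norm_one, norm_pow]
    linarith [pow_le_one₀ (n := m * (2 * n + j + 1)) h0.le hq.le]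
  calc _ ≤ ‖q‖ ^ n.choose 2 * 2 * (D * C) := by
        gcongr
        · exact h' _
        · exact h _
    _ = _ := by ring

theorem summable_hardyWrightTerm {q : ℂ} (hq0 : q ≠ 0) (hq : ‖q‖ < 1) (m j : ℕ) :
    Summable (hardyWrightTerm q m j) := by
  obtain ⟨C, hC, h⟩ := exists_hardyWrightTerm_norm_le hq0 hq m
  exact Summable.of_norm_bounded ((summable_pow_choose_two_mul_pow (norm_pos_iff.mpr hq0)
    hq one_pos).mul_left C) (h j)

/-- If `f n = u n + v n` where `u 0 = 0` and `u (n + 1) + v n = g n`, then `∑ f = ∑ g`. -/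
theorem tsum_eq_tsum_of_shift {f g u v : ℕ → ℂ} (hu : Summable u) (hv : Summable v)
    (hf : ∀ n, f n = u n + v n) (hu0 : u 0 = 0) (hg : ∀ n, u (n + 1) + v n = g n) :
    ∑' n, f n = ∑' n, g n := by
  rw [tsum_congr hf, hu.tsum_add hv, hu.tsum_eq_zero_add, hu0, zero_add,
    ← ((summable_nat_add_iff 1).mpr hu).tsum_add hv]
  exact tsum_congr hg

theorem summable_sign_pow_mul_qPoch {q : ℂ} (hq0 : q ≠ 0) (hq : ‖q‖ < 1) (a b c : ℕ) :
    Summable fun n : ℕ => (-1) ^ n * q ^ (5 * n.choose 2 + a * n + c)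
      * (qPoch q q (b + n) / qPoch q q n) := by
  obtain ⟨C, hC, h⟩ := exists_norm_inv_qPoch_self_le hq
  obtain ⟨D, hD, h'⟩ := exists_norm_qPoch_le q hq
  have h0 : 0 < ‖q‖ := norm_pos_iff.mpr hq0
  refine Summable.of_norm_bounded ((summable_pow_choose_two_mul_pow h0
    hq one_pos).mul_left (D * C)) fun n => ?_
  simp only [norm_mul, norm_pow, norm_neg, norm_one, one_pow, one_mul, mul_one, div_eq_mul_inv]
  have h1 : ‖q‖ ^ (5 * n.choose 2 + a * n + c) ≤ ‖q‖ ^ n.choose 2 :=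
    pow_le_pow_of_le_one h0.le hq.le (by nlinarith [Nat.zero_le (a * n)])
  calc _ ≤ ‖q‖ ^ n.choose 2 * (D * C) := by
        gcongr
        · exact h' _
        · exact h _
    _ = _ := by ring

/-- Split `1 - q^(2n+j+1) = (1 - q^n) + q^n (1 - q^(n+j+1))`. The first piece vanishes at `n = 0`
and is shifted; the second extends `(q;q)_{j+n}` by one factor. -/
theorem tsum_hardyWrightTerm_one {q : ℂ} (hq0 : q ≠ 0) (hq : ‖q‖ < 1) (j : ℕ) :
    ∑' n, hardyWrightTerm q 1 j n = ∑' n, hardyWrightTerm q 2 (j + 1) n := by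
  have hs := summable_sign_pow_mul_qPoch hq0 hq
  refine tsum_eq_tsum_of_shift
    (u := fun n => (-1) ^ n * q ^ (5 * n.choose 2 + (2 * j + 4) * n + 0)
      * (qPoch q q (j + n) / qPoch q q n) - (-1) ^ n * q ^ (5 * n.choose 2 + (2 * j + 5) * n + 0)
      * (qPoch q q (j + n) / qPoch q q n))
    (v := fun n => (-1) ^ n * q ^ (5 * n.choose 2 + (2 * j + 5) * n + 0)
      * (qPoch q q (j + 1 + n) / qPoch q q n))
    ((hs _ _ _).sub (hs _ _ _)) (hs _ _ _) (fun n => ?_) (by simp) fun n => ?_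
  · rw [hardyWrightTerm, show j + 1 + n = j + n + 1 by ring, qPoch_self_succ]
    simp only [Nat.add_one_sub_one, add_zero]
    ring
  · have h1 := qPoch_self_ne_zero hq n
    have h2 := one_sub_pow_ne_zero hq n.succ_ne_zero
    simp only [Nat.succ_eq_add_one] at h2
    rw [hardyWrightTerm, show j + (n + 1) = j + n + 1 by ring, show j + 1 + n = j + n + 1 by ring,
      choose_two_succ, qPoch_self_succ q n]
    field_simp
    ring

theorem tsum_hardyWrightTerm_two {q : ℂ} (hq0 : q ≠ 0) (hq : ‖q‖ < 1) (j : ℕ) :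
    ∑' n, hardyWrightTerm q 2 j n
      = ∑' n, hardyWrightTerm q 1 j n + q ^ (j + 1) * ∑' n, hardyWrightTerm q 1 (j + 1) n := by
  have hs := summable_sign_pow_mul_qPoch hq0 hq
  have hw := summable_hardyWrightTerm hq0 hq
  rw [← sub_eq_iff_eq_add', ← (hw 2 j).tsum_sub (hw 1 j), ← tsum_mul_left]
  -- The split is now `(1 - q^(4n+2j+2)) - q^n (1 - q^(2n+j+1)) = (1 - q^n) + q^(3n+j+1) (1 -
  -- q^(n+j+1))`.
  refine tsum_eq_tsum_of_shift
    (u := fun n => (-1) ^ n * q ^ (5 * n.choose 2 + (2 * j + 3) * n + 0)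
      * (qPoch q q (j + n) / qPoch q q n) - (-1) ^ n * q ^ (5 * n.choose 2 + (2 * j + 4) * n + 0)
      * (qPoch q q (j + n) / qPoch q q n))
    (v := fun n => (-1) ^ n * q ^ (5 * n.choose 2 + (2 * j + 6) * n + (j + 1))
      * (qPoch q q (j + 1 + n) / qPoch q q n))
    ((hs _ _ _).sub (hs _ _ _)) (hs _ _ _) (fun n => ?_) (by simp) fun n => ?_
  · rw [hardyWrightTerm, hardyWrightTerm, show j + 1 + n = j + n + 1 by ring, qPoch_self_succ]
    simp only [Nat.add_one_sub_one, add_zero, Nat.reduceSub]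
    ring
  · have h1 := qPoch_self_ne_zero hq n
    have h2 := one_sub_pow_ne_zero hq n.succ_ne_zero
    simp only [Nat.succ_eq_add_one] at h2
    rw [hardyWrightTerm, show j + (n + 1) = j + n + 1 by ring, show j + 1 + n = j + n + 1 by ring,
      choose_two_succ, qPoch_self_succ q n]
    field_simp
    ring

theorem tendsto_tsum_hardyWrightTerm_two {q : ℂ} (hq0 : q ≠ 0) (hq : ‖q‖ < 1) :
    Tendsto (fun j => ∑' n, hardyWrightTerm q 2 j n) atTop (𝓝 (qPochInf q q)) := by
  obtain ⟨C, hC, h⟩ := exists_hardyWrightTerm_norm_le hq0 hq 2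
  have h0 : 0 < ‖q‖ := norm_pos_iff.mpr hq0
  have key : Tendsto (fun j : ℕ => ∑' n, hardyWrightTerm q 2 j n) atTop
      (𝓝 (∑' n : ℕ, if n = 0 then qPochInf q q else 0)) := by
    refine tendsto_tsum_of_dominated_convergence
      ((summable_pow_choose_two_mul_pow h0 hq one_pos).mul_left C) (fun n => ?_)
      (Eventually.of_forall h)
    have hp : Tendsto (fun j => q ^ j) atTop (𝓝 0) := tendsto_pow_atTop_nhds_zero_of_norm_lt_one hq
    have h1 : Tendsto (fun j => qPoch q q (j + n)) atTop (𝓝 (qPochInf q q)) :=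
      (tendsto_qPoch q hq).comp (tendsto_add_atTop_nat n)
    -- With `q^j` isolated, the factor `(q^j)^(2n)` kills every term but `n = 0` in the limit.
    have h2 : Tendsto (fun j => (-1) ^ n * q ^ (5 * n.choose 2 + 3 * n) * (q ^ j) ^ (2 * n)
        * (1 - (q ^ j) ^ 2 * q ^ (4 * n + 2)) * (qPoch q q (j + n) / qPoch q q n)) atTop
        (𝓝 ((-1) ^ n * q ^ (5 * n.choose 2 + 3 * n) * 0 ^ (2 * n)
        * (1 - 0 ^ 2 * q ^ (4 * n + 2)) * (qPochInf q q / qPoch q q n))) :=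
      (((hp.pow _).const_mul _).mul (((hp.pow _).mul_const _).const_sub _)).mul (h1.div_const _)
    have h3 : (-1) ^ n * q ^ (5 * n.choose 2 + 3 * n) * 0 ^ (2 * n)
        * (1 - 0 ^ 2 * q ^ (4 * n + 2)) * (qPochInf q q / qPoch q q n)
        = if n = 0 then qPochInf q q else 0 := by
      rcases eq_or_ne n 0 with rfl | hn
      · simp [qPoch_zero]
      · simp [hn]
    rw [h3] at h2
    refine h2.congr fun j => ?_
    rw [hardyWrightTerm]
    ring
  rwa [tsum_ite_eq] at key

/-! ### Uniqueness for the recurrence, and `H_2(j) = (q;q)_∞ F_j`. -/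

/-- A null sequence with `d j = d (j + 1) + q^(j + 1) d (j + 2)` vanishes. -/
theorem eq_zero_of_rec_of_tendsto_zero {q : ℂ} (hq : ‖q‖ < 1) {d : ℕ → ℂ}
    (hd : ∀ j, d j = d (j + 1) + q ^ (j + 1) * d (j + 2)) (h : Tendsto d atTop (𝓝 0)) (j : ℕ) :
    d j = 0 := by
  set M : ℕ → ℝ := fun j => max ‖d j‖ ‖d (j + 1)‖ with hM
  have hM0 : ∀ j, 0 ≤ M j := fun j => (norm_nonneg _).trans (le_max_left _ _)
  -- Bounding `1 + x` by `exp x` turns the iterated product into the exponential of a convergent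
  -- geometric sum.
  have hstep : ∀ j, M j ≤ Real.exp (‖q‖ ^ (j + 1)) * M (j + 1) := fun j => by
    have h1 : ‖d (j + 1)‖ ≤ M (j + 1) := le_max_left _ _
    have h2 : ‖d (j + 2)‖ ≤ M (j + 1) := le_max_right _ _
    have hp : 0 ≤ ‖q‖ ^ (j + 1) := by positivity
    have he : (1 + ‖q‖ ^ (j + 1)) * M (j + 1) ≤ Real.exp (‖q‖ ^ (j + 1)) * M (j + 1) :=
      mul_le_mul_of_nonneg_right (by linarith [Real.add_one_le_exp (‖q‖ ^ (j + 1))]) (hM0 _)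
    refine le_trans (max_le ?_ ?_) he
    · rw [hd j]
      refine (norm_add_le _ _).trans ?_
      rw [norm_mul, norm_pow]
      nlinarith
    · nlinarith [hM0 (j + 1)]
  have hiter : ∀ N, M j ≤ Real.exp (∑ i ∈ Finset.range N, ‖q‖ ^ (j + i + 1)) * M (j + N) := by
    intro N
    induction N with
    | zero => simp
    | succ N ih =>
      refine ih.trans ?_
      rw [Finset.sum_range_succ, Real.exp_add, mul_assoc]
      exact mul_le_mul_of_nonneg_left (hstep _) (Real.exp_pos _).le
  have hs : Summable fun i => ‖q‖ ^ (j + i + 1) := by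
    refine ((summable_geometric_of_lt_one (norm_nonneg q) hq).mul_left (‖q‖ ^ (j + 1))).congr ?_
    intro i
    ring
  have hlim : Tendsto (fun N => Real.exp (∑' i, ‖q‖ ^ (j + i + 1)) * M (j + N)) atTop (𝓝 0) := by
    have h1 : Tendsto M atTop (𝓝 0) := by
      simpa using h.norm.max (h.comp (tendsto_add_atTop_nat 1)).norm
    have h2 : Tendsto (fun N => M (j + N)) atTop (𝓝 0) := by
      simpa only [add_comm j, Function.comp_def] using h1.comp (tendsto_add_atTop_nat j)
    simpa using h2.const_mul (Real.exp (∑' i, ‖q‖ ^ (j + i + 1)))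
  have : M j ≤ 0 := ge_of_tendsto' hlim fun N => (hiter N).trans <|
    mul_le_mul_of_nonneg_right (Real.exp_le_exp.mpr
      (hs.sum_le_tsum _ fun i _ => by positivity)) (hM0 _)
  exact norm_le_zero_iff.mp ((le_max_left _ _).trans this)

theorem tsum_hardyWrightTerm_two_eq {q : ℂ} (hq0 : q ≠ 0) (hq : ‖q‖ < 1) (j : ℕ) :
    ∑' n, hardyWrightTerm q 2 j n = qPochInf q q * ∑' n, rrTerm q j n := by
  rw [← sub_eq_zero]
  refine eq_zero_of_rec_of_tendsto_zero hq
    (d := fun j => ∑' n, hardyWrightTerm q 2 j n - qPochInf q q * ∑' n, rrTerm q j n)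
    (fun j => ?_) ?_ j
  · have h1 := tsum_rrTerm_rec hq0 hq j
    have h2 := tsum_hardyWrightTerm_two hq0 hq j
    rw [tsum_hardyWrightTerm_one hq0 hq, tsum_hardyWrightTerm_one hq0 hq] at h2
    rw [show (j : ℤ) + 1 = ((j + 1 : ℕ) : ℤ) by push_cast; ring,
      show (j : ℤ) + 2 = ((j + 2 : ℕ) : ℤ) by push_cast; ring, zpow_natCast] at h1
    simp only [h1, h2, add_assoc, one_add_one_eq_two]
    ring
  · simpa using (tendsto_tsum_hardyWrightTerm_two hq0 hq).sub
      ((tendsto_tsum_rrTerm hq0 hq).const_mul (qPochInf q q))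

/-! ### Gaussian binomials and the `q`-Pascal rule. -/

theorem gaussBinom_add (q : ℂ) (a b : ℕ) :
    gaussBinom q ((a + b : ℕ) : ℤ) a = qPoch q q (a + b) / (qPoch q q a * qPoch q q b) := by
  have h : (((a + b : ℕ) : ℤ) - a).toNat = b := by omega
  rw [gaussBinom, if_pos (by constructor <;> omega), h, Int.toNat_natCast, Int.toNat_natCast]

theorem gaussBinom_of_neg (q : ℂ) (N : ℤ) {k : ℤ} (hk : k < 0) : gaussBinom q N k = 0 :=
  if_neg (by omega)

theorem gaussBinom_of_lt (q : ℂ) {N k : ℤ} (hk : N < k) : gaussBinom q N k = 0 :=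
  if_neg (by omega)

theorem gaussBinom_zero_right {q : ℂ} (hq : ‖q‖ < 1) (N : ℕ) : gaussBinom q N 0 = 1 := by
  have := gaussBinom_add q 0 N
  rw [zero_add, qPoch_zero, one_mul, div_self (qPoch_self_ne_zero hq N)] at this
  exact_mod_cast this

theorem gaussBinom_self {q : ℂ} (hq : ‖q‖ < 1) (N : ℕ) : gaussBinom q N N = 1 := by
  have := gaussBinom_add q N 0
  rwa [add_zero, qPoch_zero, mul_one, div_self (qPoch_self_ne_zero hq N)] at this

/-- The `q`-Pascal rule, valid for all integers except `N = k = 0`. -/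
theorem gaussBinom_pascal {q : ℂ} (hq : ‖q‖ < 1) {N k : ℤ} (h : N ≠ 0 ∨ k ≠ 0) :
    gaussBinom q N k = gaussBinom q (N - 1) (k - 1) + q ^ k * gaussBinom q (N - 1) k := by
  rcases lt_or_ge k 0 with hk | hk
  · simp [gaussBinom_of_neg, hk, show k - 1 < 0 by omega]
  rcases lt_or_ge N k with hN | hN
  · simp [gaussBinom_of_lt, hN, show N - 1 < k by omega]
  lift k to ℕ using hk
  obtain ⟨d, rfl⟩ : ∃ d : ℕ, N = ((k + d : ℕ) : ℤ) := ⟨(N - k).toNat, by omega⟩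
  rcases k with _ | k
  · obtain ⟨d, rfl⟩ := Nat.exists_eq_succ_of_ne_zero (show d ≠ 0 by rintro rfl; simp at h)
    simp only [zero_add, Nat.cast_zero, zero_sub, zpow_zero, one_mul, Nat.succ_eq_add_one,
      gaussBinom_of_neg q _ (show (-1 : ℤ) < 0 by norm_num), gaussBinom_zero_right hq]
    rw [show ((d + 1 : ℕ) : ℤ) - 1 = d by push_cast; ring, gaussBinom_zero_right hq]
  have e2 : ((k + 1 : ℕ) : ℤ) - 1 = k := by push_cast; ring
  rcases d with _ | d
  · rw [add_zero, e2, gaussBinom_self hq, gaussBinom_self hq,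
      gaussBinom_of_lt q (show (k : ℤ) < (k + 1 : ℕ) by push_cast; omega)]
    ring
  · have e1 : ((k + 1 + (d + 1) : ℕ) : ℤ) - 1 = ((k + (d + 1) : ℕ) : ℤ) := by push_cast; ring
    rw [e1, e2, gaussBinom_add, gaussBinom_add, show k + (d + 1) = k + 1 + d by ring,
      gaussBinom_add, zpow_natCast, ← add_assoc, qPoch_self_succ q (k + 1 + d),
      qPoch_self_succ q k, qPoch_self_succ q d]
    have h1 := qPoch_self_ne_zero hq k
    have h2 := qPoch_self_ne_zero hq d
    have h3 := one_sub_pow_ne_zero hq k.succ_ne_zero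
    have h4 := one_sub_pow_ne_zero hq d.succ_ne_zero
    simp only [Nat.succ_eq_add_one] at h3 h4
    field_simp
    ring

/-! ### The `q`-binomial theorem and the Jacobi triple product. -/

theorem qPoch_succ' (x q : ℂ) (n : ℕ) : qPoch x q (n + 1) = (1 - x) * qPoch (x * q) q n := by
  rw [qPoch, Finset.prod_range_succ', pow_zero, mul_one, mul_comm]
  congr 1
  exact Finset.prod_congr rfl fun k _ => by ring

theorem qPoch_add (x q : ℂ) (m n : ℕ) : qPoch x q (m + n) = qPoch x q m * qPoch (x * q ^ m) q n := by
  rw [qPoch, Finset.prod_range_add]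
  congr 1
  exact Finset.prod_congr rfl fun k _ => by ring

/-- The finite `q`-binomial theorem. -/
theorem qPoch_eq_sum {q : ℂ} (hq : ‖q‖ < 1) (M : ℕ) : ∀ x : ℂ, qPoch x q M =
    ∑ k ∈ Finset.range (M + 1), (-1) ^ k * q ^ k.choose 2 * x ^ k * gaussBinom q M k := by
  induction M with
  | zero => intro x; simpa [qPoch_zero] using (gaussBinom_self hq 0).symm
  | succ M ih =>
    intro x
    -- After a shift of `k` the first summand contributes `-x (xq;q)_M`, the second `(xq;q)_M`;
    -- together they give `(1 - x)(xq;q)_M`.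
    have hP : ∀ k : ℕ, (-1) ^ k * q ^ k.choose 2 * x ^ k * gaussBinom q (M + 1 : ℕ) k
        = (-1) ^ k * q ^ k.choose 2 * x ^ k * gaussBinom q M ((k : ℤ) - 1)
          + (-1) ^ k * q ^ k.choose 2 * (x * q) ^ k * gaussBinom q M k := fun k => by
      rw [gaussBinom_pascal hq (Or.inl (by omega)),
        show ((M + 1 : ℕ) : ℤ) - 1 = M by push_cast; ring, zpow_natCast]
      ring
    rw [Finset.sum_congr rfl fun k _ => hP k, Finset.sum_add_distrib,
      Finset.sum_range_succ' _ (M + 1), Finset.sum_range_succ _ (M + 1), qPoch_succ', ih,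
      gaussBinom_of_neg q M (show ((0 : ℕ) : ℤ) - 1 < 0 by norm_num),
      gaussBinom_of_lt q (show (M : ℤ) < (M + 1 : ℕ) by omega), mul_zero, mul_zero, add_zero,
      add_zero, sub_mul, one_mul, sub_eq_neg_add, ← neg_mul, Finset.mul_sum]
    congr 1
    refine Finset.sum_congr rfl fun k _ => ?_
    rw [choose_two_succ, show ((k + 1 : ℕ) : ℤ) - 1 = k by push_cast; ring]
    ring

/-- Each factor is turned over: `1 - z/p^k = -(z/p^k)(1 - p^k/z)` for `1 ≤ k ≤ N`. -/
theorem qPoch_div_pow {p z : ℂ} (hp : p ≠ 0) (hz : z ≠ 0) (N : ℕ) :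
    qPoch (z / p ^ N) p N = (-z) ^ N / p ^ (N + 1).choose 2 * qPoch (p / z) p N := by
  induction N with
  | zero => simp [qPoch_zero]
  | succ N ih =>
    have h : z / p ^ (N + 1) * p = z / p ^ N := by field_simp; ring
    rw [qPoch_succ', h, ih, choose_two_succ (N + 1), qPoch_succ]
    field_simp
    ring

theorem choose_two_identity_sub (n d : ℕ) :
    d.choose 2 + (n + d + 1).choose 2 = (n + 1).choose 2 + (n + d) * d := by
  have h1 := two_mul_choose_two d
  have h2 := two_mul_choose_two (n + d + 1)
  have h3 := two_mul_choose_two (n + 1)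
  push_cast at h1 h2 h3
  zify
  linarith

theorem choose_two_identity_add (N n : ℕ) :
    (N + 1 + n).choose 2 + (N + 1).choose 2 = (n + 1).choose 2 + N * (N + 1 + n) := by
  have h1 := two_mul_choose_two (N + 1 + n)
  have h2 := two_mul_choose_two (N + 1)
  have h3 := two_mul_choose_two (n + 1)
  push_cast at h1 h2 h3
  zify
  linarith

/-- The finite form of the Jacobi triple product, with the terms of index `n` and `-n - 1`
collected. -/
theorem finite_triple_product {p z : ℂ} (hp0 : p ≠ 0) (hp : ‖p‖ < 1) (hz : z ≠ 0) (N : ℕ) :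
    qPoch z p (N + 1) * qPoch (p / z) p N = ∑ n ∈ Finset.range (N + 1),
      (-1) ^ n * p ^ (n + 1).choose 2 * ((z ^ n)⁻¹ - z ^ (n + 1))
        * gaussBinom p (2 * N + 1 : ℕ) ((N : ℤ) - n) := by
  have hc : (-z) ^ N / p ^ (N + 1).choose 2 ≠ 0 :=
    div_ne_zero (pow_ne_zero _ (neg_ne_zero.mpr hz)) (pow_ne_zero _ hp0)
  have hprod : qPoch (z / p ^ N) p (N + (N + 1))
      = (-z) ^ N / p ^ (N + 1).choose 2 * (qPoch z p (N + 1) * qPoch (p / z) p N) := by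
    rw [qPoch_add, qPoch_div_pow hp0 hz, div_mul_cancel₀ z (pow_ne_zero _ hp0)]
    ring
  apply mul_left_cancel₀ hc
  -- The `2N + 2` terms of the `q`-binomial expansion at `z/p^N` are cut in the middle and paired as
  -- `k = N - n` and `k = N + 1 + n`, which carry equal Gaussian binomials (`b1`, `b2`).
  rw [← hprod, qPoch_eq_sum hp, show N + (N + 1) + 1 = (N + 1) + (N + 1) by ring,
    Finset.sum_range_add, ← Finset.sum_range_reflect _ (N + 1), ← Finset.sum_add_distrib,
    Finset.mul_sum]
  refine Finset.sum_congr rfl fun n hn => ?_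
  obtain ⟨d, rfl⟩ := Nat.exists_eq_add_of_le (Finset.mem_range_succ_iff.mp hn)
  have e1 : n + d + 1 - 1 - n = d := by omega
  have e2 : (((n + d : ℕ) : ℤ) - n) = (d : ℕ) := by push_cast; ring
  have b1 : gaussBinom p (n + d + (n + d + 1) : ℕ) d
      = qPoch p p (d + (2 * n + d + 1)) / (qPoch p p d * qPoch p p (2 * n + d + 1)) := by
    rw [← gaussBinom_add]
    congr 2
    ring
  have b2 : gaussBinom p (n + d + (n + d + 1) : ℕ) (n + d + 1 + n : ℕ)
      = qPoch p p (d + (2 * n + d + 1)) / (qPoch p p d * qPoch p p (2 * n + d + 1)) := by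
    rw [show n + d + (n + d + 1) = (2 * n + d + 1) + d by ring,
      show n + d + 1 + n = 2 * n + d + 1 by ring, gaussBinom_add, add_comm d, mul_comm (qPoch p p d)]
  rw [e1, e2, show 2 * (n + d) + 1 = n + d + (n + d + 1) by ring, b1, b2]
  generalize qPoch p p (d + (2 * n + d + 1)) / (qPoch p p d * qPoch p p (2 * n + d + 1)) = B
  have i1 : p ^ d.choose 2 * p ^ (n + d + 1).choose 2
      = p ^ (n + 1).choose 2 * (p ^ (n + d)) ^ d := by
    rw [← pow_add, choose_two_identity_sub, pow_add, pow_mul]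
  have i2 : p ^ (n + d + 1 + n).choose 2 * p ^ (n + d + 1).choose 2
      = p ^ (n + 1).choose 2 * (p ^ (n + d)) ^ (n + d + 1 + n) := by
    rw [← pow_add, choose_two_identity_add, pow_add, pow_mul]
  have t1 : (-1) ^ d * p ^ d.choose 2 * (z / p ^ (n + d)) ^ d
      = (-z) ^ (n + d) / p ^ (n + d + 1).choose 2
        * ((-1) ^ n * p ^ (n + 1).choose 2 * (z ^ n)⁻¹) := by
    rw [div_pow, neg_pow z]
    have : ((-1 : ℂ) ^ n) * (-1) ^ n = 1 := by rw [← mul_pow]; simp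
    field_simp
    rw [pow_add (-1 : ℂ), pow_add z]
    linear_combination (-1) ^ d * z ^ d * z ^ n * i1
      - (-1) ^ d * z ^ d * z ^ n * (p ^ (n + 1).choose 2 * (p ^ (n + d)) ^ d) * this
  have t2 : (-1) ^ (n + d + 1 + n) * p ^ (n + d + 1 + n).choose 2
        * (z / p ^ (n + d)) ^ (n + d + 1 + n)
      = (-z) ^ (n + d) / p ^ (n + d + 1).choose 2
        * ((-1) ^ n * p ^ (n + 1).choose 2 * (- z ^ (n + 1))) := by
    rw [div_pow, neg_pow z]
    field_simp
    rw [pow_add (-1 : ℂ) (n + d + 1), pow_add (-1 : ℂ) (n + d) 1]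
    linear_combination - (-1) ^ (n + d) * (-1) ^ n * z ^ (n + d + 1 + n) * i2
  linear_combination B * t1 + B * t2

/-- The **Jacobi triple product** identity, with the terms of index `n` and `-n - 1` collected. -/
theorem triple_product {p z : ℂ} (hp0 : p ≠ 0) (hp : ‖p‖ < 1) (hz : z ≠ 0) :
    qPochInf p p * (qPochInf z p * qPochInf (p / z) p)
      = ∑' n : ℕ, (-1) ^ n * p ^ (n + 1).choose 2 * ((z ^ n)⁻¹ - z ^ (n + 1)) := by
  have hP := qPochInf_ne_zero hp hp
  obtain ⟨C, hC, hCb⟩ := exists_norm_inv_qPoch_self_le hp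
  obtain ⟨D, hD, hDb⟩ := exists_norm_qPoch_le p hp
  have hp0' : 0 < ‖p‖ := norm_pos_iff.mpr hp0
  have hz' : 0 < ‖z‖ := norm_pos_iff.mpr hz
  have hB : ∀ N k : ℤ, ‖gaussBinom p N k‖ ≤ D * (C * C) := fun N k => by
    rw [gaussBinom]
    split_ifs
    · rw [div_eq_mul_inv, mul_inv, norm_mul, norm_mul]
      gcongr
      · exact hDb _
      · exact hCb _
      · exact hCb _
    · rw [norm_zero]
      positivity
  have hlhs : Tendsto (fun N => qPoch z p (N + 1) * qPoch (p / z) p N) atTop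
      (𝓝 (qPochInf z p * qPochInf (p / z) p)) :=
    ((tendsto_qPoch z hp).comp (tendsto_add_atTop_nat 1)).mul (tendsto_qPoch (p / z) hp)
  have hrhs : Tendsto (fun N : ℕ => ∑' n : ℕ, (-1) ^ n * p ^ (n + 1).choose 2
      * ((z ^ n)⁻¹ - z ^ (n + 1)) * gaussBinom p (2 * N + 1 : ℕ) ((N : ℤ) - n)) atTop
      (𝓝 (∑' n : ℕ, (-1) ^ n * p ^ (n + 1).choose 2 * ((z ^ n)⁻¹ - z ^ (n + 1))
        * (qPochInf p p)⁻¹)) := by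
    refine tendsto_tsum_of_dominated_convergence
      (((summable_pow_choose_two_mul_pow hp0' hp (s := ‖p‖ / ‖z‖) (by positivity)).add
        ((summable_pow_choose_two_mul_pow hp0' hp (s := ‖p‖ * ‖z‖) (by positivity)).mul_left
          ‖z‖)).mul_right (D * (C * C))) (fun n => ?_) (Eventually.of_forall fun N n => ?_)
    -- For fixed `n`, the Gaussian binomial tends to `(p;p)_∞ / (p;p)_∞² = 1/(p;p)_∞`.
    · refine Tendsto.const_mul _ ?_
      have h1 : Tendsto (fun N => qPoch p p (2 * N + 1)) atTop (𝓝 (qPochInf p p)) :=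
        (tendsto_qPoch p hp).comp (tendsto_atTop_mono (fun N => by simp; omega) tendsto_id)
      have h2 : Tendsto (fun N => qPoch p p (N - n)) atTop (𝓝 (qPochInf p p)) :=
        (tendsto_qPoch p hp).comp (tendsto_sub_atTop_nat n)
      have h3 : Tendsto (fun N => qPoch p p (N + (n + 1))) atTop (𝓝 (qPochInf p p)) :=
        (tendsto_qPoch p hp).comp (tendsto_add_atTop_nat (n + 1))
      have h4 := h1.div (h2.mul h3) (mul_ne_zero hP hP)
      rw [div_mul_cancel_left₀ hP] at h4
      refine h4.congr' ?_
      filter_upwards [eventually_ge_atTop n] with N hN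
      have h5 := gaussBinom_add p (N - n) (N + (n + 1))
      rw [show N - n + (N + (n + 1)) = 2 * N + 1 by omega, Nat.cast_sub hN] at h5
      rw [h5]
      rfl
    · rw [norm_mul]
      refine mul_le_mul ?_ (hB _ _) (norm_nonneg _) (by positivity)
      rw [norm_mul, norm_mul, norm_pow, norm_neg, norm_one, one_pow, one_mul, norm_pow,
        choose_two_succ]
      refine (mul_le_mul_of_nonneg_left (norm_sub_le _ _) (by positivity)).trans_eq ?_
      simp only [norm_inv, norm_pow, div_eq_mul_inv, mul_pow, inv_pow]
      ring
  have hfin : ∀ N : ℕ, qPoch z p (N + 1) * qPoch (p / z) p N = ∑' n : ℕ,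
      (-1) ^ n * p ^ (n + 1).choose 2
      * ((z ^ n)⁻¹ - z ^ (n + 1)) * gaussBinom p (2 * N + 1 : ℕ) ((N : ℤ) - n) := fun N => by
    rw [finite_triple_product hp0 hp hz, tsum_eq_sum]
    intro n hn
    rw [gaussBinom_of_neg, mul_zero]
    simp only [Finset.mem_range] at hn
    omega
  rw [tendsto_nhds_unique (hlhs.congr hfin) hrhs, tsum_mul_right]
  field_simp

/-! ### The Rogers–Ramanujan identities. -/

theorem qPoch_five_mul (q : ℂ) (N : ℕ) : qPoch q q (5 * N) = qPoch q (q ^ 5) N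
    * qPoch (q ^ 2) (q ^ 5) N * qPoch (q ^ 3) (q ^ 5) N * qPoch (q ^ 4) (q ^ 5) N
    * qPoch (q ^ 5) (q ^ 5) N := by
  induction N with
  | zero => simp [qPoch_zero]
  | succ N ih =>
    rw [show 5 * (N + 1) = 5 * N + 1 + 1 + 1 + 1 + 1 by ring]
    simp only [qPoch_succ, ih]
    ring

theorem qPochInf_eq_prod_five {q : ℂ} (hq : ‖q‖ < 1) : qPochInf q q = qPochInf q (q ^ 5)
    * qPochInf (q ^ 2) (q ^ 5) * qPochInf (q ^ 3) (q ^ 5) * qPochInf (q ^ 4) (q ^ 5)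
    * qPochInf (q ^ 5) (q ^ 5) := by
  have h5 : ‖q ^ 5‖ < 1 := by
    rw [norm_pow]
    exact pow_lt_one₀ (norm_nonneg q) hq (by norm_num)
  have h1 : Tendsto (fun N => qPoch q q (5 * N)) atTop (𝓝 (qPochInf q q)) :=
    (tendsto_qPoch q hq).comp (tendsto_atTop_mono (fun N => by simp; omega) tendsto_id)
  refine tendsto_nhds_unique (h1.congr (qPoch_five_mul q)) ?_
  exact ((((tendsto_qPoch _ h5).mul (tendsto_qPoch _ h5)).mul (tendsto_qPoch _ h5)).mul
    (tendsto_qPoch _ h5)).mul (tendsto_qPoch _ h5)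

/-- At `j = 0` the quotient of shifted factorials is 1, leaving the triple product series with `p =
q^5`, `z = q^m`. -/
theorem tsum_hardyWrightTerm_zero {q : ℂ} (hq0 : q ≠ 0) (hq : ‖q‖ < 1) {m : ℕ} (hm : m ≤ 5) :
    ∑' n, hardyWrightTerm q m 0 n = qPochInf (q ^ 5) (q ^ 5)
      * (qPochInf (q ^ m) (q ^ 5) * qPochInf (q ^ (5 - m)) (q ^ 5)) := by
  have h5 : ‖q ^ 5‖ < 1 := by
    rw [norm_pow]
    exact pow_lt_one₀ (norm_nonneg q) hq (by norm_num)
  have h := triple_product (pow_ne_zero 5 hq0) h5 (pow_ne_zero m hq0)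
  rw [← pow_sub₀ q hq0 hm |>.trans (div_eq_mul_inv _ _).symm] at h
  rw [h]
  refine tsum_congr fun n => ?_
  obtain ⟨d, hd⟩ := Nat.exists_eq_add_of_le hm
  rw [hardyWrightTerm, zero_add, div_self (qPoch_self_ne_zero hq n), mul_one, choose_two_succ,
    show 5 - m = d by omega, ← pow_mul q m n]
  have e : q ^ (5 * n) = q ^ (m * n) * q ^ (d * n) := by rw [hd]; ring
  have e2 : (q ^ 5) ^ (n.choose 2 + n) = q ^ (5 * n.choose 2) * (q ^ (m * n) * q ^ (d * n)) := by
    rw [← e]; ring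
  rw [e2]
  field_simp
  ring

/-- The first **Rogers–Ramanujan identity**. -/
theorem rogersRamanujan_zero {q : ℂ} (hq0 : q ≠ 0) (hq : ‖q‖ < 1) :
    ∑' n, rrTerm q 0 n = (qPochInf q (q ^ 5) * qPochInf (q ^ 4) (q ^ 5))⁻¹ := by
  have hP := qPochInf_ne_zero hq hq
  have h1 := tsum_hardyWrightTerm_two_eq hq0 hq 0
  rw [tsum_hardyWrightTerm_zero hq0 hq (by norm_num)] at h1
  rw [qPochInf_eq_prod_five hq] at h1 hP
  simp only [mul_ne_zero_iff] at hP
  obtain ⟨⟨⟨⟨hP1, hP2⟩, hP3⟩, hP4⟩, hP5⟩ := hP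
  simp only [Nat.reduceSub, Nat.cast_zero] at h1
  refine eq_inv_of_mul_eq_one_left ?_
  -- Of the five residue classes in `(q;q)_∞`, the three already in `H_2(0)` cancel.
  apply mul_left_cancel₀ (mul_ne_zero (mul_ne_zero hP2 hP3) hP5)
  linear_combination -h1

/-- The second **Rogers–Ramanujan identity**. -/
theorem rogersRamanujan_one {q : ℂ} (hq0 : q ≠ 0) (hq : ‖q‖ < 1) :
    ∑' n, rrTerm q 1 n = (qPochInf (q ^ 2) (q ^ 5) * qPochInf (q ^ 3) (q ^ 5))⁻¹ := by
  have hP := qPochInf_ne_zero hq hq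
  have h1 := tsum_hardyWrightTerm_two_eq hq0 hq 1
  -- `H_2(1)` is replaced by `H_1(0)`, to which the triple product applies.
  rw [← zero_add 1, ← tsum_hardyWrightTerm_one hq0 hq,
    tsum_hardyWrightTerm_zero hq0 hq (by norm_num)] at h1
  rw [qPochInf_eq_prod_five hq] at h1 hP
  simp only [mul_ne_zero_iff] at hP
  obtain ⟨⟨⟨⟨hP1, hP2⟩, hP3⟩, hP4⟩, hP5⟩ := hP
  simp only [Nat.reduceSub, zero_add, Nat.cast_one, pow_one] at h1
  refine eq_inv_of_mul_eq_one_left ?_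
  apply mul_left_cancel₀ (mul_ne_zero (mul_ne_zero hP1 hP4) hP5)
  linear_combination -h1

/-! ### The coefficients `a_m`, `b_m` and the conclusion. -/

/-- `∑_n q^(n² - mn) [m - c - n choose n]_q` over all integers `n`. -/
noncomputable def rrCoeff (q : ℂ) (c m : ℤ) : ℂ :=
  ∑ᶠ n : ℤ, q ^ (n ^ 2 - m * n) * gaussBinom q (m - c - n) n

theorem hasFiniteSupport_rrCoeff (q : ℂ) (f : ℤ → ℂ) (M : ℤ) :
    Function.HasFiniteSupport fun n : ℤ => f n * gaussBinom q (M - n) n := by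
  refine (Set.finite_Icc 0 M).subset fun n hn => ?_
  by_contra h
  refine hn ?_
  beta_reduce
  rw [gaussBinom, if_neg, mul_zero]
  rintro ⟨h1, h2⟩
  exact h ⟨h1, by omega⟩

theorem rrCoeff_of_lt (q : ℂ) {c m : ℤ} (h : m < c) : rrCoeff q c m = 0 := by
  rw [rrCoeff, ← finsum_zero (α := ℤ)]
  refine finsum_congr fun n => ?_
  rw [gaussBinom, if_neg (by omega), mul_zero]

theorem rrCoeff_self {q : ℂ} (hq : ‖q‖ < 1) (c : ℤ) : rrCoeff q c c = 1 := by
  rw [rrCoeff, finsum_eq_single _ 0]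
  · simpa using gaussBinom_self hq 0
  · intro n hn
    rw [gaussBinom, if_neg (by omega), mul_zero]

/-- Apply `q`-Pascal termwise and shift `n` by one in the second sum. The case `m = c` is excluded
because its term `n = 0` would need the rule at `N = k = 0`, where it fails. -/
theorem rrCoeff_rec {q : ℂ} (hq0 : q ≠ 0) (hq : ‖q‖ < 1) {c m : ℤ} (h : m ≠ c) :
    rrCoeff q c m = rrCoeff q c (m - 1) + q ^ (1 - m) * rrCoeff q c (m - 2) := by
  have h1 : ∀ n : ℤ, q ^ (n ^ 2 - m * n) * gaussBinom q (m - c - n) n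
      = q ^ (n ^ 2 - (m - 1) * n) * gaussBinom q (m - 1 - c - n) n
        + q ^ (n ^ 2 - m * n) * gaussBinom q (m - 1 - c - n) (n - 1) := fun n => by
    rw [gaussBinom_pascal hq (by omega), show m - c - n - 1 = m - 1 - c - n by ring,
      show n ^ 2 - (m - 1) * n = n ^ 2 - m * n + n by ring, zpow_add₀ hq0]
    ring
  have h2 : ∀ n : ℤ, q ^ ((n + 1) ^ 2 - m * (n + 1))
      * gaussBinom q (m - 1 - c - (n + 1)) (n + 1 - 1)
      = q ^ (1 - m) * (q ^ (n ^ 2 - (m - 2) * n) * gaussBinom q (m - 2 - c - n) n) := fun n => by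
    rw [show m - 1 - c - (n + 1) = m - 2 - c - n by ring, add_sub_cancel_right, ← mul_assoc,
      ← zpow_add₀ hq0]
    congr 2
    ring
  have h3 : Function.HasFiniteSupport fun n : ℤ =>
      q ^ (n ^ 2 - m * n) * gaussBinom q (m - 1 - c - n) (n - 1) := by
    refine (Set.finite_Icc 0 (m - c + 1)).subset fun n hn => ?_
    by_contra h
    refine hn ?_
    beta_reduce
    rw [gaussBinom, if_neg, mul_zero]
    rintro ⟨h1, h2⟩
    exact h ⟨by omega, by omega⟩
  rw [rrCoeff, finsum_congr h1,
    finsum_add_distrib (hasFiniteSupport_rrCoeff q _ (m - 1 - c)) h3]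
  congr 1
  rw [rrCoeff, mul_finsum, ← finsum_congr h2]
  exact (finsum_comp_equiv (Equiv.addRight (1 : ℤ))
    (f := fun n : ℤ => q ^ (n ^ 2 - m * n) * gaussBinom q (m - 1 - c - n) (n - 1))).symm

/-- Both sides satisfy `x_m = x_{m-1} + q^(1-m) x_{m-2}` for `m ≥ 2`, so only `m = 0` and `m = 1`
need checking; the latter is `F_{-1} = F_0 + F_1`. -/
theorem tsum_rrTerm_neg {q : ℂ} (hq0 : q ≠ 0) (hq : ‖q‖ < 1) (m : ℕ) :
    ∑' n, rrTerm q (-m) n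
      = rrCoeff q 0 m * ∑' n, rrTerm q 0 n + rrCoeff q 1 m * ∑' n, rrTerm q 1 n := by
  induction m using Nat.twoStepInduction with
  | zero =>
    rw [Nat.cast_zero, rrCoeff_self hq, rrCoeff_of_lt q zero_lt_one, neg_zero]
    ring
  | one =>
    have h := tsum_rrTerm_rec hq0 hq (-1)
    rw [Nat.cast_one, rrCoeff_self hq, rrCoeff_rec hq0 hq one_ne_zero, sub_self, rrCoeff_self hq,
      rrCoeff_of_lt q (by norm_num), h]
    norm_num
  | more m ih1 ih2 =>
    have h := tsum_rrTerm_rec hq0 hq (-(m + 2 : ℕ))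
    rw [show -((m + 2 : ℕ) : ℤ) + 1 = -(m + 1 : ℕ) by push_cast; ring,
      show -((m + 2 : ℕ) : ℤ) + 2 = -m by push_cast; ring, ih1, ih2] at h
    rw [h, rrCoeff_rec hq0 hq (c := 0) (m := (m + 2 : ℕ)) (by omega),
      rrCoeff_rec hq0 hq (c := 1) (m := (m + 2 : ℕ)) (by omega),
      show ((m + 2 : ℕ) : ℤ) - 1 = (m + 1 : ℕ) by push_cast; ring,
      show ((m + 2 : ℕ) : ℤ) - 2 = m by push_cast; ring,
      show 1 - ((m + 2 : ℕ) : ℤ) = -(m + 1 : ℕ) by push_cast; ring]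
    ring

theorem corollary4p2 (m : ℕ) (hm : 1 ≤ m) (q : ℂ) (hq0 : q ≠ 0) (hq1 : ‖q‖ < 1) :
    HasSum (fun n : ℕ => q ^ ((n : ℤ) ^ 2 - (m : ℤ) * (n : ℤ)) / qPoch q q n)
      (rrA m q / (qPochInf q (q ^ 5) * qPochInf (q ^ 4) (q ^ 5))
        + rrB m q / (qPochInf (q ^ 2) (q ^ 5) * qPochInf (q ^ 3) (q ^ 5))) := by
  have h := (summable_rrTerm hq0 hq1 (-m)).hasSum
  rw [tsum_rrTerm_neg hq0 hq1, rogersRamanujan_zero hq0 hq1, rogersRamanujan_one hq0 hq1] at h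
  have hA : rrCoeff q 0 m = rrA m q := by simp only [rrCoeff, rrA, sub_zero]
  have hB : rrCoeff q 1 m = rrB m q := rfl
  rw [hA, hB, ← div_eq_mul_inv, ← div_eq_mul_inv] at h
  refine h.congr_fun fun n => ?_
  rw [rrTerm, neg_mul, ← sub_eq_add_neg]
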